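/- For $x>0$ let $$P(x)=\frac{e^{4x}+10e^{2x}+1}{4(e^{2x}-1)^2},$$ and let $A$ be the operator $Aw=-w''+Pw$ in the complex Hilbert space $L^2(0,\infty)$ with domain $$D(A)=\{w\in L^2(0,\infty): w \text{ and } w' \text{ are locally absolutely continuous on } (0,\infty),\ -w''+Pw\in L^2(0,\infty)\}.$$ Then $A$ is self-adjoint, and its discrete spectrum $\sigma_d(A)$ is empty, where $\sigma_d(A)$ denotes the set of all $\lambda\in\mathbb{C}$ for which the equation $Aw=\lambda w$ has a nonzero solution $w\in L^2(0,\infty)$. In other words, for no $\lambda\in\mathbb{C}$ is there a nonzero $w\in D(A)$ with $Aw=\lambda w$. -/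

import Mathlib

open MeasureTheory Set

noncomputable section

namespace SturmLiouville

/-- The potential `P(x) = (e^{4x} + 10 e^{2x} + 1) / (4 (e^{2x} - 1)^2)`, used for `x > 0`. -/
def potential (x : ℝ) : ℝ :=
  (Real.exp (4 * x) + 10 * Real.exp (2 * x) + 1) / (4 * (Real.exp (2 * x) - 1) ^ 2)

/-- Lebesgue measure on the half-line `(0, ∞)`. -/
def halfLine : Measure ℝ := volume.restrict (Ioi 0)

/-- The complex Hilbert space `L²(0, ∞)`. -/
abbrev L2 : Type := Lp ℂ 2 halfLine

/-- Locally absolutely continuous functions on `(0, ∞)`: absolutely continuous on every compact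
subinterval `[a, b]` of `(0, ∞)`. -/
def LocallyAC (w : ℝ → ℂ) : Prop :=
  ∀ a b : ℝ, 0 < a → a < b → AbsolutelyContinuousOnInterval w a b

/-- The differential expression `-w'' + P w`. -/
def expression (w : ℝ → ℂ) (x : ℝ) : ℂ :=
  -deriv (deriv w) x + (potential x : ℂ) * w x

/-- The functions in the maximal domain: `w ∈ L²(0, ∞)`, `w` and `w'` are locally absolutely
continuous on `(0, ∞)`, and `-w'' + P w ∈ L²(0, ∞)`. -/
structure InDomain (w : ℝ → ℂ) : Prop where
  memLp : MemLp w 2 halfLine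
  differentiable : ∀ x : ℝ, 0 < x → DifferentiableAt ℝ w x
  locallyAC : LocallyAC w
  locallyAC_deriv : LocallyAC (deriv w)
  memLp_expression : MemLp (expression w) 2 halfLine

lemma ae_differentiableAt_of_locallyAC {w : ℝ → ℂ} (h : LocallyAC w) :
    ∀ᵐ x ∂halfLine, DifferentiableAt ℝ w x := by
  have key : ∀ n : ℕ, ∀ᵐ x : ℝ, x ∈ Ioo (1 / ((n : ℝ) + 2)) ((n : ℝ) + 2) →
      DifferentiableAt ℝ w x := by
    intro n
    have hn : (0 : ℝ) ≤ n := n.cast_nonneg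
    have h0 : (0 : ℝ) < 1 / ((n : ℝ) + 2) := by positivity
    have h1 : 1 / ((n : ℝ) + 2) < (n : ℝ) + 2 := by
      rw [div_lt_iff₀ (by positivity)]; nlinarith
    have hb := (h _ _ h0 h1).boundedVariationOn
    rw [uIcc_of_le h1.le] at hb
    filter_upwards [hb.locallyBoundedVariationOn.ae_differentiableWithinAt_of_mem] with x hx hxm
    exact (hx (Ioo_subset_Icc_self hxm)).differentiableAt (Icc_mem_nhds hxm.1 hxm.2)
  rw [halfLine, ae_restrict_iff' measurableSet_Ioi]
  filter_upwards [ae_all_iff.2 key] with x hx hx0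
  have hx0 : 0 < x := hx0
  obtain ⟨n, hn⟩ := exists_nat_gt (max x (1 / x))
  have h1 : x < n := (le_max_left _ _).trans_lt hn
  have h2 : 1 / x < n := (le_max_right _ _).trans_lt hn
  refine hx n ⟨?_, by linarith⟩
  rw [div_lt_iff₀ (by positivity)]
  rw [div_lt_iff₀ hx0] at h2
  nlinarith

lemma InDomain.eqOn_of_ae_eq {v w : ℝ → ℂ} (hv : InDomain v) (hw : InDomain w)
    (h : v =ᵐ[halfLine] w) : EqOn v w (Ioi 0) :=
  Measure.eqOn_open_of_ae_eq h isOpen_Ioi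
    (fun x hx => (hv.differentiable x hx).continuousAt.continuousWithinAt)
    (fun x hx => (hw.differentiable x hx).continuousAt.continuousWithinAt)

lemma deriv_eqOn {v w : ℝ → ℂ} (h : EqOn v w (Ioi 0)) : EqOn (deriv v) (deriv w) (Ioi 0) :=
  fun _ hx => (h.eventuallyEq_of_mem (Ioi_mem_nhds hx)).deriv_eq

lemma expression_eqOn {v w : ℝ → ℂ} (h : EqOn v w (Ioi 0)) :
    EqOn (expression v) (expression w) (Ioi 0) := fun x hx => by
  simp only [expression, deriv_eqOn (deriv_eqOn h) hx, h hx]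

lemma ae_eq_of_eqOn {v w : ℝ → ℂ} (h : EqOn v w (Ioi 0)) : v =ᵐ[halfLine] w :=
  (ae_restrict_iff' measurableSet_Ioi).2 (Filter.Eventually.of_forall h)

lemma LocallyAC.congr {v w : ℝ → ℂ} (hv : LocallyAC v) (h : EqOn v w (Ioi 0)) :
    LocallyAC w := by
  intro a b ha hab
  have := hv a b ha hab
  rw [absolutelyContinuousOnInterval_iff] at this ⊢
  intro ε hε
  obtain ⟨δ, hδ, H⟩ := this ε hε
  refine ⟨δ, hδ, fun E hE hl => ?_⟩
  convert! H E hE hl using 1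
  refine Finset.sum_congr rfl fun i hi => ?_
  obtain ⟨h1, h2⟩ := hE.1 i hi
  rw [uIcc_of_le hab.le] at h1 h2
  rw [h (show _ ∈ Ioi (0 : ℝ) from ha.trans_le h1.1),
    h (show _ ∈ Ioi (0 : ℝ) from ha.trans_le h2.1)]

lemma InDomain.deriv_add_eqOn {v w : ℝ → ℂ} (hv : InDomain v) (hw : InDomain w) :
    EqOn (deriv v + deriv w) (deriv (v + w)) (Ioi 0) := fun x hx => by
  rw [deriv_add (hv.differentiable x hx) (hw.differentiable x hx), Pi.add_apply]

lemma InDomain.deriv_smul_eqOn {w : ℝ → ℂ} (hw : InDomain w) (c : ℂ) :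
    EqOn (c • deriv w) (deriv (c • w)) (Ioi 0) := fun x hx => by
  rw [deriv_const_smul c (hw.differentiable x hx), Pi.smul_apply]

lemma InDomain.expression_add {v w : ℝ → ℂ} (hv : InDomain v) (hw : InDomain w) :
    expression (v + w) =ᵐ[halfLine] expression v + expression w := by
  filter_upwards [ae_differentiableAt_of_locallyAC hv.locallyAC_deriv,
    ae_differentiableAt_of_locallyAC hw.locallyAC_deriv,
    ae_eq_of_eqOn (deriv_eqOn (hv.deriv_add_eqOn hw))] with x h1 h2 h3
  simp only [expression, Pi.add_apply, ← h3, deriv_add h1 h2]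
  ring

lemma InDomain.expression_smul {w : ℝ → ℂ} (hw : InDomain w) (c : ℂ) :
    expression (c • w) =ᵐ[halfLine] c • expression w := by
  filter_upwards [ae_differentiableAt_of_locallyAC hw.locallyAC_deriv,
    ae_eq_of_eqOn (deriv_eqOn (hw.deriv_smul_eqOn c))] with x h1 h2
  simp only [expression, Pi.smul_apply, ← h2, deriv_const_smul c h1, smul_eq_mul]
  ring

lemma InDomain.add {v w : ℝ → ℂ} (hv : InDomain v) (hw : InDomain w) : InDomain (v + w) where
  memLp := hv.memLp.add hw.memLp
  differentiable x hx := (hv.differentiable x hx).add (hw.differentiable x hx)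
  locallyAC a b ha hab := (hv.locallyAC a b ha hab).add (hw.locallyAC a b ha hab)
  locallyAC_deriv := LocallyAC.congr
    (fun a b ha hab => (hv.locallyAC_deriv a b ha hab).add (hw.locallyAC_deriv a b ha hab))
    (hv.deriv_add_eqOn hw)
  memLp_expression :=
    (hv.memLp_expression.add hw.memLp_expression).ae_eq (hv.expression_add hw).symm

lemma InDomain.smul {w : ℝ → ℂ} (hw : InDomain w) (c : ℂ) : InDomain (c • w) where
  memLp := hw.memLp.const_smul c
  differentiable x hx := (hw.differentiable x hx).const_smul c
  locallyAC a b ha hab := (hw.locallyAC a b ha hab).const_smul c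
  locallyAC_deriv := LocallyAC.congr
    (fun a b ha hab => (hw.locallyAC_deriv a b ha hab).const_smul c) (hw.deriv_smul_eqOn c)
  memLp_expression := (hw.memLp_expression.const_smul c).ae_eq (hw.expression_smul c).symm

lemma inDomain_zero : InDomain 0 where
  memLp := MemLp.zero
  differentiable x _ := differentiableAt_const (0 : ℂ)
  locallyAC a b _ _ := by
    rw [absolutelyContinuousOnInterval_iff]
    exact fun ε hε => ⟨1, one_pos, fun E _ _ => by simpa using hε⟩
  locallyAC_deriv a b _ _ := by
    rw [absolutelyContinuousOnInterval_iff]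
    exact fun ε hε => ⟨1, one_pos, fun E _ _ => by simpa using hε⟩
  memLp_expression := by
    have : expression 0 = 0 := by ext x; simp [expression]
    rw [this]; exact MemLp.zero

/-- The domain `D(A)` as a subspace of `L²(0, ∞)`: the classes of the functions in `InDomain`. -/
def domain : Submodule ℂ L2 where
  carrier := {u | ∃ w : ℝ → ℂ, InDomain w ∧ u =ᵐ[halfLine] w}
  add_mem' := by
    rintro u v ⟨w, hw, hu⟩ ⟨z, hz, hv⟩
    exact ⟨w + z, hw.add hz, (Lp.coeFn_add u v).trans (hu.add hv)⟩
  zero_mem' := ⟨0, inDomain_zero, Lp.coeFn_zero ℂ 2 halfLine⟩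
  smul_mem' := by
    rintro c u ⟨w, hw, hu⟩
    exact ⟨c • w, hw.smul c, (Lp.coeFn_smul c u).trans (hu.const_smul c)⟩

/-- The regular representative of an element of `D(A)`; it is unique on `(0, ∞)`. -/
def rep (u : domain) : ℝ → ℂ := u.2.choose

lemma rep_inDomain (u : domain) : InDomain (rep u) := u.2.choose_spec.1

lemma coe_ae_eq_rep (u : domain) : (u : L2) =ᵐ[halfLine] rep u := u.2.choose_spec.2

/-- The value of `-w'' + P w` does not depend on the representative `w`. -/
lemma expression_rep_ae_eq (u : domain) {w : ℝ → ℂ} (hw : InDomain w)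
    (h : (u : L2) =ᵐ[halfLine] w) : expression (rep u) =ᵐ[halfLine] expression w :=
  ae_eq_of_eqOn (expression_eqOn ((rep_inDomain u).eqOn_of_ae_eq hw ((coe_ae_eq_rep u).symm.trans h)))

/-- The Sturm–Liouville operator `A w = -w'' + P w` in `L²(0, ∞)` with domain `D(A)`. -/
def operator : L2 →ₗ.[ℂ] L2 where
  domain := domain
  toFun :=
    { toFun := fun u => (rep_inDomain u).memLp_expression.toLp (expression (rep u))
      map_add' := fun u v => by
        rw [← MemLp.toLp_add, MemLp.toLp_eq_toLp_iff]
        exact (expression_rep_ae_eq (u + v) ((rep_inDomain u).add (rep_inDomain v))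
          ((Lp.coeFn_add (u : L2) v).trans ((coe_ae_eq_rep u).add (coe_ae_eq_rep v)))).trans
          ((rep_inDomain u).expression_add (rep_inDomain v))
      map_smul' := fun c u => by
        rw [RingHom.id_apply, ← MemLp.toLp_const_smul, MemLp.toLp_eq_toLp_iff]
        exact (expression_rep_ae_eq (c • u) ((rep_inDomain u).smul c)
          ((Lp.coeFn_smul c (u : L2)).trans ((coe_ae_eq_rep u).const_smul c))).trans
          ((rep_inDomain u).expression_smul c) }

/-- The discrete spectrum of a (possibly unbounded) operator `T`: the set of all `μ ∈ ℂ` for which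
`T w = μ w` has a nonzero solution `w` in the domain of `T`. -/
def discreteSpectrum (T : L2 →ₗ.[ℂ] L2) : Set ℂ :=
  {μ | ∃ w : T.domain, (w : L2) ≠ 0 ∧ T w = μ • (w : L2)}

end SturmLiouville

end

open Filter Topology

noncomputable section

/-! ### Local absolute continuity and the fundamental theorem of calculus on the half-line. -/

namespace SturmLiouville

/-! The potential is `1/4 + 3/(4 sinh² x)`, and at energy zero the equation is solved explicitly by
`psi = sinh^(-1/2)` and `phi = (cosh - 1) psi`, with Wronskian 1. The Green kernel `phi (min x y) *
psi (max x y)` is real, symmetric and at most `exp (-|x - y|/2)`, so it defines a symmetric operator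
on L² that is a right inverse of `A`. Since `phi` is not square integrable at infinity nor `psi` at
the origin, `A` is injective (`eqOn_zero_of_expression_eq_zero`). So every domain element is a Green
potential: `A` is symmetric and surjective, hence self-adjoint, with no boundary terms to discuss.

An eigenvalue `l` is therefore real, and an eigenfunction `w` equals the Green potential of `l w`.
The energy `|w'|² + (l - P)|w|²` has derivative `-P'|w|² ≥ 0`. It is nonnegative because `w = o(x)`
at the origin (`tendsto_green_div`) while `P ≤ 1/x²` there. It is nonpositive because `w` and `w'`
are square integrable near infinity (`norm_greenDeriv_le`), so a positive value would persist to the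
right and contradict integrability. The energy vanishes identically, and since `P' < 0` so does `w`
(`eqOn_zero_of_energy`). -/

lemma ae_halfLine_of_forall_Ioo {p : ℝ → Prop}
    (h : ∀ a b : ℝ, 0 < a → a < b → ∀ᵐ x, x ∈ Ioo a b → p x) : ∀ᵐ x ∂halfLine, p x := by
  -- Countable exhaustion of the half-line; `n + 2` makes the interval nonempty already at `n = 0`.
  have key : ∀ n : ℕ, ∀ᵐ x : ℝ, x ∈ Ioo (1 / ((n : ℝ) + 2)) ((n : ℝ) + 2) → p x := by
    intro n
    have hn : (0 : ℝ) ≤ n := n.cast_nonneg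
    refine h _ _ (by positivity) ?_
    rw [div_lt_iff₀ (by positivity)]
    nlinarith
  rw [halfLine, ae_restrict_iff' measurableSet_Ioi]
  filter_upwards [ae_all_iff.2 key] with x hx hx0
  have hx0 : 0 < x := hx0
  obtain ⟨n, hn⟩ := exists_nat_gt (max x (1 / x))
  have h1 : x < n := (le_max_left _ _).trans_lt hn
  have h2 : 1 / x < n := (le_max_right _ _).trans_lt hn
  refine hx n ⟨?_, by linarith⟩
  rw [div_lt_iff₀ (by positivity)]
  rw [div_lt_iff₀ hx0] at h2
  nlinarith

lemma ae_halfLine_iff {p : ℝ → Prop} : (∀ᵐ x ∂halfLine, p x) ↔ ∀ᵐ x, 0 < x → p x :=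
  ae_restrict_iff' measurableSet_Ioi

lemma ae_halfLine_pos : ∀ᵐ x ∂halfLine, 0 < x :=
  ae_halfLine_iff.2 (Eventually.of_forall fun _ h => h)

lemma _root_.IntervalIntegrable.absolutelyContinuousOnInterval_intervalIntegral_complex
    {g : ℝ → ℂ} {a b c : ℝ} (h : IntervalIntegrable g volume a b) (hc : c ∈ uIcc a b) :
    AbsolutelyContinuousOnInterval (fun x => ∫ t in c..x, g t) a b := by
  have hre : IntervalIntegrable (fun t => (g t).re) volume a b := ⟨h.1.re, h.2.re⟩
  have him : IntervalIntegrable (fun t => (g t).im) volume a b := ⟨h.1.im, h.2.im⟩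
  have h1 := hre.absolutelyContinuousOnInterval_intervalIntegral hc
  have h2 := him.absolutelyContinuousOnInterval_intervalIntegral hc
  have hone : AbsolutelyContinuousOnInterval (fun _ : ℝ => (1 : ℂ)) a b :=
    contDiffOn_const.absolutelyContinuousOnInterval
  have hI : AbsolutelyContinuousOnInterval (fun _ : ℝ => Complex.I) a b :=
    contDiffOn_const.absolutelyContinuousOnInterval
  have key := (h1.smul hone).add (h2.smul hI)
  rw [absolutelyContinuousOnInterval_iff] at key ⊢
  have heq : ∀ x ∈ uIcc a b, ∫ t in c..x, g t =
      (((fun x => ∫ t in c..x, (g t).re) • fun _ : ℝ => (1 : ℂ)) +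
        ((fun x => ∫ t in c..x, (g t).im) • fun _ : ℝ => Complex.I)) x := by
    intro x hx
    have hcx : IntervalIntegrable g volume c x := h.mono_set (uIcc_subset_uIcc hc hx)
    have e1 : ∫ t in c..x, (g t).re = (∫ t in c..x, g t).re := by
      simpa using (Complex.reCLM.intervalIntegral_comp_comm hcx)
    have e2 : ∫ t in c..x, (g t).im = (∫ t in c..x, g t).im := by
      simpa using (Complex.imCLM.intervalIntegral_comp_comm hcx)
    simp only [Pi.add_apply, Pi.smul_apply', e1, e2, Complex.real_smul, mul_one]
    exact (Complex.re_add_im _).symm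
  intro ε hε
  obtain ⟨δ, hδ, H⟩ := key ε hε
  refine ⟨δ, hδ, fun E hE hl => ?_⟩
  convert! H E hE hl using 1
  refine Finset.sum_congr rfl fun i hi => ?_
  obtain ⟨h1, h2⟩ := hE.1 i hi
  rw [heq _ h1, heq _ h2]

lemma uIcc_subset_Ioi {a b : ℝ} (ha : 0 < a) (hb : 0 < b) : uIcc a b ⊆ Ioi 0 :=
  fun _ hx => (lt_min ha hb).trans_le hx.1

/-- Integrability on the compact subintervals of `(0, ∞)`. -/
def LocallyInt (g : ℝ → ℂ) : Prop :=
  ∀ a b : ℝ, 0 < a → 0 < b → IntervalIntegrable g volume a b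

lemma LocallyInt.of_continuousOn {g : ℝ → ℂ} (hg : ContinuousOn g (Ioi 0)) : LocallyInt g :=
  fun _ _ ha hb => (hg.mono (uIcc_subset_Ioi ha hb)).intervalIntegrable

lemma LocallyInt.locallyAC_primitive {g : ℝ → ℂ} (hg : LocallyInt g) :
    LocallyAC (fun x => ∫ t in (1 : ℝ)..x, g t) := by
  intro a b ha hab
  have h := (hg (min a 1) (max b 1) (by positivity)
    (by positivity)).absolutelyContinuousOnInterval_intervalIntegral_complex
    (c := 1) (mem_uIcc_of_le (min_le_right _ _) (le_max_right _ _))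
  exact h.mono (uIcc_subset_uIcc (mem_uIcc_of_le (min_le_left _ _) (hab.le.trans (le_max_left _ _)))
    (mem_uIcc_of_le ((min_le_left _ _).trans hab.le) (le_max_left _ _)))

lemma LocallyInt.ae_hasDerivAt_primitive {g : ℝ → ℂ} (hg : LocallyInt g) :
    ∀ᵐ x ∂halfLine, HasDerivAt (fun x => ∫ t in (1 : ℝ)..x, g t) (g x) x := by
  refine ae_halfLine_of_forall_Ioo fun a b ha hab => ?_
  have h := (hg (min a 1) (max b 1) (by positivity) (by positivity)).ae_hasDerivAt_integral
  filter_upwards [h] with x hx hxab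
  refine hx (mem_uIcc_of_le ((min_le_left _ _).trans hxab.1.le) (hxab.2.le.trans (le_max_left _ _)))
    1 (mem_uIcc_of_le (min_le_right _ _) (le_max_right _ _))

lemma LocallyAC.add {v w : ℝ → ℂ} (hv : LocallyAC v) (hw : LocallyAC w) :
    LocallyAC (fun x => v x + w x) := fun a b ha hab => (hv a b ha hab).add (hw a b ha hab)

lemma LocallyAC.sub {v w : ℝ → ℂ} (hv : LocallyAC v) (hw : LocallyAC w) :
    LocallyAC (fun x => v x - w x) := fun a b ha hab => (hv a b ha hab).sub (hw a b ha hab)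

lemma locallyAC_const (c : ℂ) : LocallyAC (fun _ => c) := fun _ _ _ _ =>
  contDiffOn_const.absolutelyContinuousOnInterval

lemma LocallyAC.continuousOn {w : ℝ → ℂ} (hw : LocallyAC w) : ContinuousOn w (Ioi 0) := by
  intro x hx
  have hx : 0 < x := hx
  have h := (hw (x / 2) (2 * x) (by linarith) (by linarith)).continuousOn
  rw [uIcc_of_le (by linarith)] at h
  exact (h.continuousAt (Icc_mem_nhds (by linarith) (by linarith))).continuousWithinAt

lemma LocallyAC.eq_of_ae_hasDerivAt_zero {F : ℝ → ℂ} (hF : LocallyAC F)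
    (h : ∀ᵐ x ∂halfLine, HasDerivAt F 0 x) {x : ℝ} (hx : 0 < x) : F x = F 1 := by
  have hm : 0 < min x 1 := by positivity
  -- The `+ 1` keeps the interval nondegenerate when `x = 1`.
  have hlt : min x 1 < max x 1 + 1 := by linarith [min_le_right x 1, le_max_right x 1]
  have hsub : uIcc (min x 1) (max x 1 + 1) ⊆ Ioi 0 := uIcc_subset_Ioi hm (hm.trans hlt)
  obtain ⟨C, hC⟩ := (hF _ _ hm hlt).const_of_ae_hasDerivAt_zero (by
    filter_upwards [ae_halfLine_iff.1 h] with y hy hmem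
    exact hy (hsub hmem))
  rw [hC x (mem_uIcc_of_le (min_le_left _ _) (by linarith [le_max_left x 1])),
    hC 1 (mem_uIcc_of_le (min_le_right _ _) (by linarith [le_max_right x 1]))]

/-- `F` differs by a constant from the primitive of the continuous function `g`, so the exceptional
null set disappears. -/
lemma LocallyAC.hasDerivAt_of_ae {F g : ℝ → ℂ} (hF : LocallyAC F) (hg : ContinuousOn g (Ioi 0))
    (h : ∀ᵐ x ∂halfLine, HasDerivAt F (g x) x) {x : ℝ} (hx : 0 < x) : HasDerivAt F (g x) x := by
  have hint := LocallyInt.of_continuousOn hg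
  have hconst : ∀ y, 0 < y → F y = (∫ t in (1 : ℝ)..y, g t) + F 1 := by
    intro y hy
    have := (hF.sub hint.locallyAC_primitive).eq_of_ae_hasDerivAt_zero (by
      filter_upwards [h, hint.ae_hasDerivAt_primitive] with z h1 h2
      simpa using! h1.sub h2) hy
    simp only [intervalIntegral.integral_same, sub_zero] at this
    rw [← this]; ring
  have hd : HasDerivAt (fun y => (∫ t in (1 : ℝ)..y, g t) + F 1) (g x) x := by
    refine (intervalIntegral.integral_hasDerivAt_right (hint 1 x one_pos hx) ?_
      (hg.continuousAt (Ioi_mem_nhds hx))).add_const _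
    exact hg.stronglyMeasurableAtFilter isOpen_Ioi x hx
  exact hd.congr_of_eventuallyEq (Filter.mem_of_superset (Ioi_mem_nhds hx) hconst)

lemma LocallyAC.smul_of_hasDerivAt {c c' : ℝ → ℝ} {F : ℝ → ℂ} (hF : LocallyAC F)
    (hc : ∀ x, 0 < x → HasDerivAt c (c' x) x) (hc' : ContinuousOn c' (Ioi 0)) :
    LocallyAC (fun x => c x • F x) := by
  intro a b ha hab
  have hsub : uIcc a b ⊆ Ioi 0 := uIcc_subset_Ioi ha (ha.trans hab)
  have hd : ContDiffOn ℝ 1 c (Ioi 0) := by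
    rw [show (1 : WithTop ℕ∞) = 0 + 1 from (zero_add 1).symm,
      contDiffOn_succ_iff_deriv_of_isOpen isOpen_Ioi]
    refine ⟨fun x hx => (hc x hx).differentiableAt.differentiableWithinAt, by simp, ?_⟩
    exact contDiffOn_zero.2 (hc'.congr fun x hx => (hc x hx).deriv)
  exact (hd.mono hsub).absolutelyContinuousOnInterval.smul (hF a b ha hab)

/-! ### Explicit solutions at energy zero. -/

lemma sinh_pos {x : ℝ} (hx : 0 < x) : 0 < Real.sinh x := Real.sinh_pos_iff.2 hx

/-- The zero-energy solution decaying at infinity. -/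
def psi (x : ℝ) : ℝ := (√(Real.sinh x))⁻¹

/-- The derivative of `psi` on `(0, ∞)`. -/
def psi' (x : ℝ) : ℝ := -(Real.cosh x / (2 * Real.sinh x)) * psi x

/-- The zero-energy solution that is small at the origin. -/
def phi (x : ℝ) : ℝ := (Real.cosh x - 1) * psi x

/-- The derivative of `phi` on `(0, ∞)`. -/
def phi' (x : ℝ) : ℝ := Real.sinh x * psi x + (Real.cosh x - 1) * psi' x

/-- The numerator is `(e^{2x} - 1)² + 12 e^{2x}`. This form shows the singularity at the origin and
that the potential decreases. -/
lemma potential_eq {x : ℝ} (hx : 0 < x) :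
    potential x = 1 / 4 + 3 / 4 / Real.sinh x ^ 2 := by
  have h1 : Real.exp (2 * x) = Real.exp x ^ 2 := by rw [← Real.exp_nat_mul]; norm_num
  have h2 : Real.exp (4 * x) = Real.exp x ^ 4 := by rw [← Real.exp_nat_mul]; norm_num
  have hpos := Real.exp_pos x
  have h3 : 1 < Real.exp x := Real.one_lt_exp_iff.2 hx
  have h4 : Real.exp x ^ 2 - 1 ≠ 0 := by nlinarith
  have hs : Real.sinh x = (Real.exp x ^ 2 - 1) / (2 * Real.exp x) := by
    rw [Real.sinh_eq, Real.exp_neg]; field_simp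
  rw [potential, h1, h2, hs]
  field_simp
  ring

lemma psi_pos {x : ℝ} (hx : 0 < x) : 0 < psi x := by
  have := sinh_pos hx
  unfold psi; positivity

lemma psi_sq {x : ℝ} (hx : 0 < x) : Real.sinh x * psi x ^ 2 = 1 := by
  have := sinh_pos hx
  rw [psi, inv_pow, Real.sq_sqrt this.le, mul_inv_cancel₀ this.ne']

lemma sinh_mul_psi {x : ℝ} (hx : 0 < x) : Real.sinh x * psi x = √(Real.sinh x) := by
  have h := sinh_pos hx
  rw [psi, ← div_eq_mul_inv, Real.div_sqrt]

lemma hasDerivAt_psi {x : ℝ} (hx : 0 < x) : HasDerivAt psi (psi' x) x := by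
  have hs := sinh_pos hx
  have h := ((Real.hasDerivAt_sinh x).sqrt hs.ne').inv (Real.sqrt_pos.2 hs).ne'
  convert! h using 1
  rw [psi', psi, Real.sq_sqrt hs.le]
  field_simp

lemma hasDerivAt_psi' {x : ℝ} (hx : 0 < x) : HasDerivAt psi' (potential x * psi x) x := by
  have hs := sinh_pos hx
  have h := (((Real.hasDerivAt_cosh x).div ((Real.hasDerivAt_sinh x).const_mul 2)
    (by positivity)).neg).mul (hasDerivAt_psi hx)
  convert! h using 1
  rw [psi', potential_eq hx]
  simp only [Pi.neg_apply, Pi.div_apply]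
  field_simp
  have := Real.cosh_sq x
  rw [this]; ring

lemma hasDerivAt_phi {x : ℝ} (hx : 0 < x) : HasDerivAt phi (phi' x) x :=
  ((Real.hasDerivAt_cosh x).sub_const 1).mul (hasDerivAt_psi hx)

lemma hasDerivAt_phi' {x : ℝ} (hx : 0 < x) : HasDerivAt phi' (potential x * phi x) x := by
  have hs := sinh_pos hx
  have h := ((Real.hasDerivAt_sinh x).mul (hasDerivAt_psi hx)).add
    (((Real.hasDerivAt_cosh x).sub_const 1).mul (hasDerivAt_psi' hx))
  convert! h using 1
  rw [phi, psi']
  field_simp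
  ring

/-- As `phi` is `(cosh - 1) psi`, the Wronskian is `(cosh - 1)' psi² = sinh · psi²`. -/
lemma wronskian {x : ℝ} (hx : 0 < x) : phi' x * psi x - phi x * psi' x = 1 := by
  rw [← psi_sq hx, phi', phi]; ring

lemma continuousOn_psi : ContinuousOn psi (Ioi 0) :=
  fun _ hx => (hasDerivAt_psi hx).continuousAt.continuousWithinAt

lemma continuousOn_psi' : ContinuousOn psi' (Ioi 0) :=
  fun _ hx => (hasDerivAt_psi' hx).continuousAt.continuousWithinAt

lemma continuousOn_phi : ContinuousOn phi (Ioi 0) :=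
  fun _ hx => (hasDerivAt_phi hx).continuousAt.continuousWithinAt

lemma continuousOn_phi' : ContinuousOn phi' (Ioi 0) :=
  fun _ hx => (hasDerivAt_phi' hx).continuousAt.continuousWithinAt

lemma hasDerivAt_potential {x : ℝ} (hx : 0 < x) :
    HasDerivAt potential (-(3 / 2 * Real.cosh x / Real.sinh x ^ 3)) x := by
  have hs := sinh_pos hx
  have h := (((Real.hasDerivAt_sinh x).pow 2).inv (by simp; positivity)).const_mul (3 / 4 : ℝ)
    |>.const_add (1 / 4)
  refine HasDerivAt.congr_of_eventuallyEq (f := fun x => 1 / 4 + 3 / 4 * (Real.sinh x ^ 2)⁻¹) ?_ ?_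
  · convert! h using 1
    simp only [Pi.pow_apply]
    field_simp
    norm_num
    ring
  · filter_upwards [Ioi_mem_nhds hx] with y hy
    rw [potential_eq hy, div_eq_mul_inv (3 / 4 : ℝ)]

lemma continuousOn_potential : ContinuousOn potential (Ioi 0) :=
  fun _ hx => (hasDerivAt_potential hx).continuousAt.continuousWithinAt

lemma potential_pos {x : ℝ} (hx : 0 < x) : 0 < potential x := by
  rw [potential_eq hx]
  have := sinh_pos hx
  positivity

lemma cosh_sub_one_le_sinh {x : ℝ} (hx : 0 < x) : Real.cosh x - 1 ≤ Real.sinh x := by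
  have := Real.cosh_sub_sinh x
  have h2 : Real.exp (-x) ≤ 1 := Real.exp_le_one_iff.2 (by linarith)
  linarith

lemma phi_pos {x : ℝ} (hx : 0 < x) : 0 < phi x :=
  mul_pos (by linarith [Real.one_lt_cosh.2 hx.ne']) (psi_pos hx)

lemma phi_le {x : ℝ} (hx : 0 < x) : phi x ≤ √(Real.sinh x) := by
  rw [← sinh_mul_psi hx]
  exact mul_le_mul_of_nonneg_right (cosh_sub_one_le_sinh hx) (psi_pos hx).le

/-- `cosh y - 1 - y sinh y` vanishes at 0 and has derivative `-y cosh y`. The factor `x` gained over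
`phi_le` yields the decay of Green potentials at the origin. -/
lemma phi_le_mul {x : ℝ} (hx : 0 < x) : phi x ≤ x * √(Real.sinh x) := by
  rw [← sinh_mul_psi hx, ← mul_assoc]
  refine mul_le_mul_of_nonneg_right ?_ (psi_pos hx).le
  have hanti : AntitoneOn (fun y => Real.cosh y - 1 - y * Real.sinh y) (Ici 0) := by
    refine antitoneOn_of_deriv_nonpos (convex_Ici 0) (by fun_prop) (by fun_prop) ?_
    intro y hy
    rw [interior_Ici] at hy
    have hd : HasDerivAt (fun y => Real.cosh y - 1 - y * Real.sinh y)
        (Real.sinh y - (1 * Real.sinh y + y * Real.cosh y)) y :=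
      ((Real.hasDerivAt_cosh y).sub_const 1).sub ((hasDerivAt_id y).mul (Real.hasDerivAt_sinh y))
    rw [hd.deriv]
    have := mul_pos (show 0 < y from hy) (Real.cosh_pos y)
    linarith
  have := hanti (mem_Ici.2 le_rfl) (mem_Ici.2 hx.le) hx.le
  simp at this
  linarith

/-! ### Exponential bounds and the Green kernel. -/

/-- The exponential kernel dominating the Green function. -/
def expKernel (t : ℝ) : ℝ := Real.exp (-|t| / 2)

lemma expKernel_pos (t : ℝ) : 0 < expKernel t := Real.exp_pos _

lemma continuous_expKernel : Continuous expKernel := by unfold expKernel; fun_prop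

lemma expKernel_le_one (t : ℝ) : expKernel t ≤ 1 :=
  Real.exp_le_one_iff.2 (by linarith [abs_nonneg t])

lemma expKernel_neg (t : ℝ) : expKernel (-t) = expKernel t := by simp [expKernel]

lemma expKernel_sub_comm (s t : ℝ) : expKernel (s - t) = expKernel (t - s) := by
  rw [← expKernel_neg, neg_sub]

lemma integrable_expKernel : Integrable expKernel := by
  have h : IntegrableOn expKernel (Ioi 0) := by
    refine (integrableOn_exp_mul_Ioi (show (-1 / 2 : ℝ) < 0 by norm_num) 0).congr_fun ?_
      measurableSet_Ioi
    intro t ht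
    simp only [expKernel, abs_of_pos (show (0 : ℝ) < t from ht)]
    ring_nf
  have h' : IntegrableOn expKernel (Iic 0) := by
    refine (integrableOn_exp_mul_Iic (show (0 : ℝ) < 1 / 2 by norm_num) 0).congr_fun ?_
      measurableSet_Iic
    intro t ht
    simp only [expKernel, abs_of_nonpos (show t ≤ 0 from ht)]
    ring_nf
  rw [← integrableOn_univ, ← Iic_union_Ioi (a := (0 : ℝ))]
  exact h'.union h

/-- For `x ≤ y` one has `sinh x / sinh y ≤ e^{x - y}`; the square root turns this into decay at rate
1/2. -/
lemma sqrt_sinh_mul_psi_le {x y : ℝ} (hx : 0 < x) (hxy : x ≤ y) :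
    √(Real.sinh x) * psi y ≤ expKernel (x - y) := by
  have hy := hx.trans_le hxy
  have hsx := sinh_pos hx
  have hsy := sinh_pos hy
  rw [psi, ← div_eq_mul_inv, ← Real.sqrt_div hsx.le]
  refine Real.sqrt_le_iff.2 ⟨(expKernel_pos _).le, ?_⟩
  have h1 : expKernel (x - y) ^ 2 = Real.exp x / Real.exp y := by
    rw [expKernel, ← Real.exp_nat_mul, abs_of_nonpos (by linarith), ← Real.exp_sub]
    congr 1
    push_cast
    ring
  rw [h1, div_le_div_iff₀ hsy (Real.exp_pos y)]
  rw [Real.sinh_eq, Real.sinh_eq]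
  have h2 : Real.exp (-y) * Real.exp x ≤ Real.exp (-x) * Real.exp y := by
    rw [← Real.exp_add, ← Real.exp_add]
    exact Real.exp_le_exp.2 (by linarith)
  nlinarith

/-- Away from the origin `coth x ≤ 2`, which follows from `e^x ≥ 2`. -/
lemma abs_psi'_le {x : ℝ} (hx : 1 ≤ x) : |psi' x| ≤ psi x := by
  have hx0 : 0 < x := by linarith
  have hs := sinh_pos hx0
  rw [psi', abs_mul, abs_neg, abs_of_pos (psi_pos hx0),
    abs_of_pos (div_pos (Real.cosh_pos x) (by positivity))]
  refine mul_le_of_le_one_left (psi_pos hx0).le ?_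
  rw [div_le_one (by positivity), Real.cosh_eq, Real.sinh_eq]
  have h1 : 2 ≤ Real.exp x := by linarith [Real.add_one_le_exp x]
  have h2 : Real.exp (-x) ≤ 1 / 2 := by
    rw [Real.exp_neg, one_div]
    exact inv_anti₀ (by norm_num) h1
  linarith

lemma abs_phi'_le {x : ℝ} (hx : 1 ≤ x) : |phi' x| ≤ 2 * √(Real.sinh x) := by
  have hx0 : 0 < x := by linarith
  have hs := sinh_pos hx0
  have hp := psi_pos hx0
  have hc : 0 ≤ Real.cosh x - 1 := by linarith [Real.one_le_cosh x]
  have h1 : |(Real.cosh x - 1) * psi' x| ≤ Real.sinh x * psi x := by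
    rw [abs_mul, abs_of_nonneg hc]
    exact mul_le_mul (cosh_sub_one_le_sinh hx0) (abs_psi'_le hx) (abs_nonneg _) hs.le
  rw [← sinh_mul_psi hx0, phi']
  refine (abs_add_le _ _).trans ?_
  rw [abs_of_pos (mul_pos hs hp)]
  linarith

/-- The Green function of the operator at energy zero. -/
def greenKernel (x y : ℝ) : ℝ := phi (min x y) * psi (max x y)

lemma greenKernel_comm (x y : ℝ) : greenKernel x y = greenKernel y x := by
  rw [greenKernel, greenKernel, min_comm, max_comm]

lemma greenKernel_of_le {x y : ℝ} (h : y ≤ x) : greenKernel x y = phi y * psi x := by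
  rw [greenKernel, min_eq_right h, max_eq_left h]

lemma greenKernel_of_ge {x y : ℝ} (h : x ≤ y) : greenKernel x y = phi x * psi y := by
  rw [greenKernel, min_eq_left h, max_eq_right h]

lemma greenKernel_nonneg {x y : ℝ} (hx : 0 < x) (hy : 0 < y) : 0 ≤ greenKernel x y :=
  (mul_pos (phi_pos (lt_min hx hy)) (psi_pos (hx.trans_le (le_max_left _ _)))).le

lemma phi_mul_psi_le {x y : ℝ} (hx : 0 < x) (hxy : x ≤ y) : phi x * psi y ≤ expKernel (x - y) :=
  (mul_le_mul_of_nonneg_right (phi_le hx) (psi_pos (hx.trans_le hxy)).le).trans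
    (sqrt_sinh_mul_psi_le hx hxy)

lemma greenKernel_le {x y : ℝ} (hx : 0 < x) (hy : 0 < y) : greenKernel x y ≤ expKernel (x - y) := by
  rcases le_total x y with h | h
  · rw [greenKernel_of_ge h]; exact phi_mul_psi_le hx h
  · rw [greenKernel_of_le h, expKernel_sub_comm]; exact phi_mul_psi_le hy h

lemma measurable_psi : Measurable psi := by unfold psi; fun_prop

lemma measurable_phi : Measurable phi :=
  (Real.measurable_cosh.sub_const 1).mul measurable_psi

lemma measurable_greenKernel : Measurable (fun p : ℝ × ℝ => greenKernel p.1 p.2) :=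
  (measurable_phi.comp (measurable_fst.min measurable_snd)).mul
    (measurable_psi.comp (measurable_fst.max measurable_snd))

instance : SFinite halfLine := by unfold halfLine; infer_instance

/-! ### L² bounds and symmetry of the Green operator. -/

section

variable {f g : ℝ → ℂ}

lemma integrable_norm_sq (hf : MemLp f 2 halfLine) : Integrable (fun y => ‖f y‖ ^ 2) halfLine :=
  (memLp_two_iff_integrable_sq_norm hf.1).1 hf

lemma integrable_expKernel_sub (x : ℝ) : Integrable (fun y => expKernel (x - y)) halfLine :=
  (integrable_expKernel.comp_sub_left x).restrict

lemma integrable_expKernel_mul_sq (hf : MemLp f 2 halfLine) (x : ℝ) :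
    Integrable (fun y => expKernel (x - y) * ‖f y‖ ^ 2) halfLine := by
  refine (integrable_norm_sq hf).mono' ?_ (Eventually.of_forall fun y => ?_)
  · exact (continuous_expKernel.comp (continuous_const.sub continuous_id)).aestronglyMeasurable.mul
      (integrable_norm_sq hf).1
  · rw [Real.norm_of_nonneg (mul_nonneg (expKernel_pos _).le (by positivity))]
    exact mul_le_of_le_one_left (by positivity) (expKernel_le_one _)

lemma integrable_expKernel_mul (hf : MemLp f 2 halfLine) (x : ℝ) :
    Integrable (fun y => expKernel (x - y) * ‖f y‖) halfLine := by
  -- Domination through `k|f| ≤ k + k|f|²`.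
  refine ((integrable_expKernel_sub x).add (integrable_expKernel_mul_sq hf x)).mono' ?_
    (Eventually.of_forall fun y => ?_)
  · exact (continuous_expKernel.comp (continuous_const.sub continuous_id)).aestronglyMeasurable.mul
      hf.1.norm
  · rw [Real.norm_of_nonneg (mul_nonneg (expKernel_pos _).le (by positivity))]
    simp only [Pi.add_apply]
    nlinarith [expKernel_pos (x - y), sq_nonneg (‖f y‖ - 1), norm_nonneg (f y),
      mul_nonneg (expKernel_pos (x - y)).le (sq_nonneg (‖f y‖ - 1)),
      mul_nonneg (expKernel_pos (x - y)).le (sq_nonneg (‖f y‖))]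

/-- The convolution of `|f|` with the exponential kernel. -/
def expConv (f : ℝ → ℂ) (x : ℝ) : ℝ := ∫ y, expKernel (x - y) * ‖f y‖ ∂halfLine

lemma integrable_prod_expKernel_mul_sq (hf : MemLp f 2 halfLine) :
    Integrable (fun p : ℝ × ℝ => expKernel (p.1 - p.2) * ‖f p.2‖ ^ 2)
      ((volume : Measure ℝ).prod halfLine) := by
  have := (integrable_norm_sq hf).convolution_integrand (ContinuousLinearMap.mul ℝ ℝ)
    integrable_expKernel
  simpa [mul_comm] using this

lemma prod_halfLine_le :
    halfLine.prod halfLine ≤ (volume : Measure ℝ).prod halfLine := by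
  have : halfLine.prod halfLine = ((volume : Measure ℝ).prod halfLine).restrict (Ioi 0 ×ˢ univ) := by
    rw [← Measure.prod_restrict, Measure.restrict_univ]; rfl
  rw [this]
  exact Measure.restrict_le_self

/-- Cauchy–Schwarz for the weight `expKernel (x - ·)`, whose mass on the half-line is at most its
mass `C` on the whole line. It comes from expanding the integral of the weight times `(|f| - a/C)²`,
which is nonnegative. -/
lemma expConv_sq_le (hf : MemLp f 2 halfLine) (x : ℝ) :
    expConv f x ^ 2 ≤ (∫ t, expKernel t) * ∫ y, expKernel (x - y) * ‖f y‖ ^ 2 ∂halfLine := by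
  set C := ∫ t, expKernel t with hC
  set a := expConv f x with ha
  have hCpos : 0 < C := by
    refine (integral_pos_iff_support_of_nonneg (fun t => (expKernel_pos t).le)
      integrable_expKernel).2 ?_
    rw [Function.support_eq_univ fun t => (expKernel_pos t).ne']
    simp
  have hc : ∫ y, expKernel (x - y) ∂halfLine ≤ C := by
    rw [hC, ← integral_sub_left_eq_self expKernel volume x]
    exact setIntegral_le_integral (integrable_expKernel.comp_sub_left x)
      (Eventually.of_forall fun t => (expKernel_pos _).le)
  have h0 : 0 ≤ ∫ y, expKernel (x - y) * (‖f y‖ - a / C) ^ 2 ∂halfLine :=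
    integral_nonneg fun _ => mul_nonneg (expKernel_pos _).le (sq_nonneg _)
  have h1 : ∫ y, expKernel (x - y) * (‖f y‖ - a / C) ^ 2 ∂halfLine =
      (∫ y, expKernel (x - y) * ‖f y‖ ^ 2 ∂halfLine) - 2 * (a / C) * a +
        (a / C) ^ 2 * ∫ y, expKernel (x - y) ∂halfLine := by
    rw [ha, expConv, ← integral_const_mul, ← integral_const_mul, ← integral_sub, ← integral_add]
    · congr 1; ext y; ring
    · exact (integrable_expKernel_mul_sq hf x).sub ((integrable_expKernel_mul hf x).const_mul _)
    · exact (integrable_expKernel_sub x).const_mul _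
    · exact integrable_expKernel_mul_sq hf x
    · exact (integrable_expKernel_mul hf x).const_mul _
  have h2 : (a / C) ^ 2 * ∫ y, expKernel (x - y) ∂halfLine ≤ (a / C) ^ 2 * C :=
    mul_le_mul_of_nonneg_left hc (sq_nonneg _)
  have h3 : (a / C) ^ 2 * C = a ^ 2 / C := by field_simp
  have h4 : 2 * (a / C) * a = 2 * (a ^ 2 / C) := by ring
  have h5 : a ^ 2 / C ≤ ∫ y, expKernel (x - y) * ‖f y‖ ^ 2 ∂halfLine := by linarith
  rwa [div_le_iff₀' hCpos] at h5

/-- A Young-type estimate: by `expConv_sq_le` the square is dominated by the convolution of two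
integrable functions, the kernel and `|f|²`. -/
lemma integrable_of_norm_le_expConv_sq (hf : MemLp f 2 halfLine) {s : Set ℝ}
    (hs : MeasurableSet s) {u : ℝ → ℂ}
    (hu : AEStronglyMeasurable u (volume.restrict s)) {c : ℝ}
    (h : ∀ x ∈ s, ‖u x‖ ≤ c * expConv f x) : IntegrableOn (fun x => ‖u x‖ ^ 2) s := by
  have hB : Integrable (fun x => ∫ y, expKernel (x - y) * ‖f y‖ ^ 2 ∂halfLine) :=
    (integrable_prod_expKernel_mul_sq hf).integral_prod_left
  refine ((hB.const_mul (c ^ 2 * ∫ t, expKernel t)).integrableOn (s := s)).mono'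
    (hu.norm.pow 2) ?_
  filter_upwards [ae_restrict_mem hs] with x hx
  rw [Real.norm_of_nonneg (by positivity)]
  calc ‖u x‖ ^ 2 ≤ (c * expConv f x) ^ 2 := by gcongr; exact h x hx
    _ = c ^ 2 * expConv f x ^ 2 := by ring
    _ ≤ c ^ 2 * ((∫ t, expKernel t) * ∫ y, expKernel (x - y) * ‖f y‖ ^ 2 ∂halfLine) := by
      gcongr; exact expConv_sq_le hf x
    _ = _ := by ring

/-- The Green operator at energy zero. -/
def green (f : ℝ → ℂ) (x : ℝ) : ℂ := ∫ y, greenKernel x y • f y ∂halfLine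

lemma norm_greenKernel_smul_le {x y : ℝ} (hx : 0 < x) (hy : 0 < y) (z : ℂ) :
    ‖greenKernel x y • z‖ ≤ expKernel (x - y) * ‖z‖ := by
  rw [norm_smul, Real.norm_of_nonneg (greenKernel_nonneg hx hy)]
  exact mul_le_mul_of_nonneg_right (greenKernel_le hx hy) (norm_nonneg _)

lemma integrable_greenKernel_smul (hf : MemLp f 2 halfLine) {x : ℝ} (hx : 0 < x) :
    Integrable (fun y => greenKernel x y • f y) halfLine := by
  refine (integrable_expKernel_mul hf x).mono' ?_ ?_
  · exact (measurable_greenKernel.comp (measurable_const.prodMk measurable_id)).aestronglyMeasurable.smul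
      hf.1
  · filter_upwards [ae_halfLine_pos] with y hy
    exact norm_greenKernel_smul_le hx hy _

lemma norm_green_le (hf : MemLp f 2 halfLine) {x : ℝ} (hx : 0 < x) :
    ‖green f x‖ ≤ expConv f x := by
  refine norm_integral_le_of_norm_le (integrable_expKernel_mul hf x) ?_
  filter_upwards [ae_halfLine_pos] with y hy
  exact norm_greenKernel_smul_le hx hy _

/-- Fubini for a real symmetric kernel; absolute integrability follows from `|f(x)||g(y)| ≤ |f(x)|²
+ |g(y)|²` against the exponential kernel. -/
lemma integral_green_mul_comm (hf : MemLp f 2 halfLine) (hg : MemLp g 2 halfLine) :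
    ∫ x, starRingEnd ℂ (f x) * green g x ∂halfLine =
      ∫ x, starRingEnd ℂ (green f x) * g x ∂halfLine := by
  have hint : Integrable (fun p : ℝ × ℝ => starRingEnd ℂ (f p.1) * (greenKernel p.1 p.2 • g p.2))
      (halfLine.prod halfLine) := by
    have h1 : Integrable (fun p : ℝ × ℝ => expKernel (p.1 - p.2) * ‖g p.2‖ ^ 2)
        (halfLine.prod halfLine) :=
      (integrable_prod_expKernel_mul_sq hg).mono_measure prod_halfLine_le
    have h2 : Integrable (fun p : ℝ × ℝ => expKernel (p.1 - p.2) * ‖f p.1‖ ^ 2)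
        (halfLine.prod halfLine) := by
      have := ((integrable_prod_expKernel_mul_sq hf).mono_measure prod_halfLine_le).swap
      refine this.congr (Eventually.of_forall fun p => ?_)
      simp [expKernel_sub_comm]
    refine (h1.add h2).mono' ?_ ?_
    · refine (RCLike.continuous_conj.comp_aestronglyMeasurable hf.1.comp_fst).mul ?_
      exact measurable_greenKernel.aestronglyMeasurable.smul hg.1.comp_snd
    · have hpos : ∀ᵐ p : ℝ × ℝ ∂(halfLine.prod halfLine), 0 < p.1 ∧ 0 < p.2 :=
        (Measure.quasiMeasurePreserving_fst.ae ae_halfLine_pos).and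
          (Measure.quasiMeasurePreserving_snd.ae ae_halfLine_pos)
      filter_upwards [hpos] with p hp
      rw [norm_mul, RCLike.norm_conj]
      have h3 := norm_greenKernel_smul_le hp.1 hp.2 (g p.2)
      have h4 := mul_le_mul_of_nonneg_left h3 (norm_nonneg (f p.1))
      refine h4.trans ?_
      simp only [Pi.add_apply]
      nlinarith [mul_nonneg (expKernel_pos (p.1 - p.2)).le (sq_nonneg (‖f p.1‖ - ‖g p.2‖)),
        mul_nonneg (expKernel_pos (p.1 - p.2)).le (sq_nonneg (‖f p.1‖)),
        mul_nonneg (expKernel_pos (p.1 - p.2)).le (sq_nonneg (‖g p.2‖))]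
  calc ∫ x, starRingEnd ℂ (f x) * green g x ∂halfLine
      = ∫ x, ∫ y, starRingEnd ℂ (f x) * (greenKernel x y • g y) ∂halfLine ∂halfLine := by
        simp only [green, integral_const_mul]
    _ = ∫ y, ∫ x, starRingEnd ℂ (f x) * (greenKernel x y • g y) ∂halfLine ∂halfLine :=
        integral_integral_swap hint
    _ = ∫ x, starRingEnd ℂ (green f x) * g x ∂halfLine := by
        congr 1; ext y
        rw [green, ← integral_conj, ← integral_mul_const]
        congr 1; ext x
        rw [greenKernel_comm y x]
        simp only [Complex.real_smul, map_mul, Complex.conj_ofReal]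
        ring

end

/-! ### The Green operator as a right inverse. -/

section

variable {f g w : ℝ → ℂ}

/-- The coefficient of `psi` in the Green operator. -/
def lowerCoeff (f : ℝ → ℂ) (x : ℝ) : ℂ := ∫ y in Ioc 0 x, phi y • f y

/-- The coefficient of `phi` in the Green operator. -/
def upperCoeff (f : ℝ → ℂ) (x : ℝ) : ℂ := ∫ y in Ioi x, psi y • f y

/-- The derivative of `green f`. -/
def greenDeriv (f : ℝ → ℂ) (x : ℝ) : ℂ := psi' x • lowerCoeff f x + phi' x • upperCoeff f x

/-- For `y ≤ x` the kernel is `phi y` times the nonzero constant `psi x`, so its integrability is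
inherited. -/
lemma integrableOn_phi_smul (hf : MemLp f 2 halfLine) {x : ℝ} (hx : 0 < x) :
    IntegrableOn (fun y => phi y • f y) (Ioc 0 x) := by
  have h : IntegrableOn (fun y => greenKernel x y • f y) (Ioc 0 x) :=
    IntegrableOn.mono_set (integrable_greenKernel_smul hf hx) Ioc_subset_Ioi_self
  refine IntegrableOn.congr_fun (Integrable.smul (psi x)⁻¹ h) (fun y hy => ?_) measurableSet_Ioc
  simp only [Pi.smul_apply, greenKernel_of_le hy.2]
  rw [smul_smul, mul_comm (phi y), inv_mul_cancel_left₀ (psi_pos hx).ne']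

lemma integrableOn_psi_smul (hf : MemLp f 2 halfLine) {x : ℝ} (hx : 0 < x) :
    IntegrableOn (fun y => psi y • f y) (Ioi x) := by
  have h : IntegrableOn (fun y => greenKernel x y • f y) (Ioi x) :=
    IntegrableOn.mono_set (integrable_greenKernel_smul hf hx) (Ioi_subset_Ioi hx.le)
  refine IntegrableOn.congr_fun (Integrable.smul (phi x)⁻¹ h) (fun y hy => ?_) measurableSet_Ioi
  simp only [Pi.smul_apply, greenKernel_of_ge (le_of_lt (show x < y from hy))]
  rw [smul_smul, inv_mul_cancel_left₀ (phi_pos hx).ne']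

lemma green_eq (hf : MemLp f 2 halfLine) {x : ℝ} (hx : 0 < x) :
    green f x = psi x • lowerCoeff f x + phi x • upperCoeff f x := by
  have hint : IntegrableOn (fun y => greenKernel x y • f y) (Ioi 0) :=
    integrable_greenKernel_smul hf hx
  rw [green, halfLine, ← Ioc_union_Ioi_eq_Ioi hx.le,
    setIntegral_union (Ioc_disjoint_Ioi le_rfl) measurableSet_Ioi
      (hint.mono_set Ioc_subset_Ioi_self) (hint.mono_set (Ioi_subset_Ioi hx.le)),
    lowerCoeff, upperCoeff, ← integral_smul, ← integral_smul]
  congr 1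
  · refine setIntegral_congr_fun measurableSet_Ioc fun y hy => ?_
    simp only [greenKernel_of_le hy.2, smul_smul, mul_comm]
  · refine setIntegral_congr_fun measurableSet_Ioi fun y hy => ?_
    simp only [greenKernel_of_ge (le_of_lt (show x < y from hy)), smul_smul]

lemma locallyInt_phi_smul (hf : MemLp f 2 halfLine) : LocallyInt fun y => phi y • f y := by
  intro a b ha hb
  rw [intervalIntegrable_iff]
  exact (integrableOn_phi_smul hf (lt_max_of_lt_left hb)).mono_set
    (Ioc_subset_Ioc (lt_min ha hb).le (by rw [max_comm]))

lemma locallyInt_psi_smul (hf : MemLp f 2 halfLine) : LocallyInt fun y => psi y • f y := by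
  intro a b ha hb
  rw [intervalIntegrable_iff]
  exact (integrableOn_psi_smul hf (lt_min ha hb)).mono_set Ioc_subset_Ioi_self

lemma lowerCoeff_eq (hf : MemLp f 2 halfLine) {x : ℝ} (hx : 0 < x) :
    lowerCoeff f x = lowerCoeff f 1 + ∫ y in (1 : ℝ)..x, phi y • f y := by
  have h0 : ∀ z : ℝ, 0 < z → IntervalIntegrable (fun y => phi y • f y) volume 0 z := fun z hz =>
    (intervalIntegrable_iff_integrableOn_Ioc_of_le hz.le).2 (integrableOn_phi_smul hf hz)
  rw [lowerCoeff, lowerCoeff, ← intervalIntegral.integral_of_le hx.le,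
    ← intervalIntegral.integral_of_le zero_le_one,
    intervalIntegral.integral_add_adjacent_intervals (h0 1 one_pos)
      (locallyInt_phi_smul hf 1 x one_pos hx)]

lemma upperCoeff_eq (hf : MemLp f 2 halfLine) {x : ℝ} (hx : 0 < x) :
    upperCoeff f x = upperCoeff f 1 - ∫ y in (1 : ℝ)..x, psi y • f y := by
  rw [upperCoeff, upperCoeff, ← intervalIntegral.integral_Ioi_sub_Ioi'
    (integrableOn_psi_smul hf one_pos) (integrableOn_psi_smul hf hx)]
  ring

lemma locallyAC_lowerCoeff (hf : MemLp f 2 halfLine) : LocallyAC (lowerCoeff f) :=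
  ((locallyAC_const _).add (locallyInt_phi_smul hf).locallyAC_primitive).congr
    fun _ hx => (lowerCoeff_eq hf hx).symm

lemma locallyAC_upperCoeff (hf : MemLp f 2 halfLine) : LocallyAC (upperCoeff f) :=
  ((locallyAC_const _).sub (locallyInt_psi_smul hf).locallyAC_primitive).congr
    fun _ hx => (upperCoeff_eq hf hx).symm

lemma ae_hasDerivAt_lowerCoeff (hf : MemLp f 2 halfLine) :
    ∀ᵐ x ∂halfLine, HasDerivAt (lowerCoeff f) (phi x • f x) x := by
  filter_upwards [(locallyInt_phi_smul hf).ae_hasDerivAt_primitive, ae_halfLine_pos] with x h hx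
  exact (h.const_add _).congr_of_eventuallyEq
    (Filter.mem_of_superset (Ioi_mem_nhds hx) fun y hy => lowerCoeff_eq hf hy)

lemma ae_hasDerivAt_upperCoeff (hf : MemLp f 2 halfLine) :
    ∀ᵐ x ∂halfLine, HasDerivAt (upperCoeff f) (-(psi x • f x)) x := by
  filter_upwards [(locallyInt_psi_smul hf).ae_hasDerivAt_primitive, ae_halfLine_pos] with x h hx
  exact (h.const_sub _).congr_of_eventuallyEq
    (Filter.mem_of_superset (Ioi_mem_nhds hx) fun y hy => upperCoeff_eq hf hy)

lemma continuousOn_potential_mul_psi : ContinuousOn (fun x => potential x * psi x) (Ioi 0) :=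
  continuousOn_potential.mul continuousOn_psi

lemma continuousOn_potential_mul_phi : ContinuousOn (fun x => potential x * phi x) (Ioi 0) :=
  continuousOn_potential.mul continuousOn_phi

lemma locallyAC_green (hf : MemLp f 2 halfLine) : LocallyAC (green f) :=
  (((locallyAC_lowerCoeff hf).smul_of_hasDerivAt (fun _ => hasDerivAt_psi) continuousOn_psi').add
    ((locallyAC_upperCoeff hf).smul_of_hasDerivAt (fun _ => hasDerivAt_phi) continuousOn_phi')).congr
    fun _ hx => (green_eq hf hx).symm

lemma locallyAC_greenDeriv (hf : MemLp f 2 halfLine) : LocallyAC (greenDeriv f) :=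
  ((locallyAC_lowerCoeff hf).smul_of_hasDerivAt (fun _ => hasDerivAt_psi')
    continuousOn_potential_mul_psi).add
    ((locallyAC_upperCoeff hf).smul_of_hasDerivAt (fun _ => hasDerivAt_phi')
      continuousOn_potential_mul_phi)

/-- Variation of parameters: the terms `psi phi f` and `-phi psi f` from differentiating the
coefficients cancel. The remaining derivative is continuous, so the a.e. identity holds everywhere.
-/
lemma hasDerivAt_green (hf : MemLp f 2 halfLine) {x : ℝ} (hx : 0 < x) :
    HasDerivAt (green f) (greenDeriv f x) x := by
  refine (locallyAC_green hf).hasDerivAt_of_ae (locallyAC_greenDeriv hf).continuousOn ?_ hx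
  filter_upwards [ae_hasDerivAt_lowerCoeff hf, ae_hasDerivAt_upperCoeff hf, ae_halfLine_pos]
    with y h1 h2 hy
  refine HasDerivAt.congr_of_eventuallyEq ?_
    (Filter.mem_of_superset (Ioi_mem_nhds hy) fun z hz => green_eq hf hz)
  convert! ((hasDerivAt_psi hy).smul h1).add ((hasDerivAt_phi hy).smul h2) using 1
  simp only [greenDeriv, Complex.real_smul]
  ring

/-- Here the coefficient terms add up to `(psi' phi - phi' psi) f`, which is `-f` because the
Wronskian is 1. -/
lemma ae_hasDerivAt_greenDeriv (hf : MemLp f 2 halfLine) :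
    ∀ᵐ x ∂halfLine, HasDerivAt (greenDeriv f) ((potential x : ℂ) * green f x - f x) x := by
  filter_upwards [ae_hasDerivAt_lowerCoeff hf, ae_hasDerivAt_upperCoeff hf, ae_halfLine_pos]
    with y h1 h2 hy
  convert! ((hasDerivAt_psi' hy).smul h1).add ((hasDerivAt_phi' hy).smul h2) using 1
  rw [green_eq hf hy]
  have hw : ((phi' y : ℂ) * psi y - phi y * psi' y) = 1 := by exact_mod_cast wronskian hy
  simp only [Complex.real_smul, Complex.ofReal_mul]
  linear_combination f y * hw

lemma deriv_green_eqOn (hf : MemLp f 2 halfLine) : EqOn (greenDeriv f) (deriv (green f)) (Ioi 0) :=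
  fun _ hx => (hasDerivAt_green hf hx).deriv.symm

lemma expression_green (hf : MemLp f 2 halfLine) : expression (green f) =ᵐ[halfLine] f := by
  filter_upwards [ae_hasDerivAt_greenDeriv hf, ae_halfLine_pos] with x h hx
  rw [expression, ← deriv_eqOn (deriv_green_eqOn hf) hx, h.deriv]
  ring

lemma memLp_green (hf : MemLp f 2 halfLine) : MemLp (green f) 2 halfLine := by
  have hm : AEStronglyMeasurable (green f) halfLine :=
    (locallyAC_green hf).continuousOn.aestronglyMeasurable measurableSet_Ioi
  refine (memLp_two_iff_integrable_sq_norm hm).2 ?_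
  exact integrable_of_norm_le_expConv_sq hf measurableSet_Ioi hm (c := 1)
    fun x hx => by rw [one_mul]; exact norm_green_le hf hx

lemma inDomain_green (hf : MemLp f 2 halfLine) : InDomain (green f) where
  memLp := memLp_green hf
  differentiable _ hx := (hasDerivAt_green hf hx).differentiableAt
  locallyAC := locallyAC_green hf
  locallyAC_deriv := (locallyAC_greenDeriv hf).congr (deriv_green_eqOn hf)
  memLp_expression := hf.ae_eq (expression_green hf).symm

/-! ### Injectivity: no square-integrable solution at energy zero. -/

/-- The derivative `c w'' - c'' w` vanishes a.e. because both functions solve the same equation, and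
the Wronskian is locally absolutely continuous. -/
lemma exists_wronskian_const {c c' : ℝ → ℝ} (hc : ∀ x, 0 < x → HasDerivAt c (c' x) x)
    (hc' : ∀ x, 0 < x → HasDerivAt c' (potential x * c x) x) (hw : InDomain w)
    (h : expression w =ᵐ[halfLine] 0) :
    ∃ k : ℂ, ∀ x, 0 < x → c x • deriv w x - c' x • w x = k := by
  have hAC : LocallyAC fun x => c x • deriv w x - c' x • w x :=
    (hw.locallyAC_deriv.smul_of_hasDerivAt hc
      fun x hx => (hc' x hx).continuousAt.continuousWithinAt).sub
    (hw.locallyAC.smul_of_hasDerivAt hc'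
      (continuousOn_potential.mul fun x hx => (hc x hx).continuousAt.continuousWithinAt))
  refine ⟨_, fun x hx => hAC.eq_of_ae_hasDerivAt_zero ?_ hx⟩
  filter_upwards [h, ae_differentiableAt_of_locallyAC hw.locallyAC_deriv, ae_halfLine_pos]
    with y h1 h2 hy
  convert! ((hc y hy).smul h2.hasDerivAt).sub
    ((hc' y hy).smul (hw.differentiable y hy).hasDerivAt) using 1
  simp only [expression, Pi.zero_apply] at h1
  simp only [Complex.real_smul, Complex.ofReal_mul]
  linear_combination (c y : ℂ) * h1

lemma psi_le_one {x : ℝ} (hx : 1 ≤ x) : psi x ≤ 1 := by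
  refine inv_le_one_of_one_le₀ (Real.one_le_sqrt.2 ?_)
  exact hx.trans (Real.self_le_sinh_iff.2 (by linarith))

lemma tendsto_psi_atTop : Tendsto psi atTop (𝓝 0) := by
  refine tendsto_inv_atTop_zero.comp (Real.tendsto_sqrt_atTop.comp ?_)
  exact tendsto_atTop_mono' _ ((eventually_ge_atTop 0).mono fun x hx =>
    Real.self_le_sinh_iff.2 hx) tendsto_id

lemma tendsto_phi_atTop : Tendsto phi atTop atTop := by
  have h1 : Tendsto (fun x => √(Real.sinh x)) atTop atTop :=
    Real.tendsto_sqrt_atTop.comp (tendsto_atTop_mono' _ ((eventually_ge_atTop 0).mono fun x hx =>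
      Real.self_le_sinh_iff.2 hx) tendsto_id)
  refine tendsto_atTop_mono' _ ?_ (tendsto_atTop_add_const_right _ (-1) h1)
  filter_upwards [eventually_ge_atTop 1] with x hx
  have hx0 : 0 < x := by linarith
  rw [← sinh_mul_psi hx0, phi]
  nlinarith [psi_le_one hx, psi_pos hx0, Real.sinh_lt_cosh x]

lemma not_integrableOn_of_le_Ioi {u : ℝ → ℝ} {a ε : ℝ} (hε : 0 < ε) (h : ∀ x, a < x → ε ≤ u x) :
    ¬ IntegrableOn u (Ioi a) := by
  intro hu
  have : IntegrableOn (fun _ : ℝ => ε) (Ioi a) :=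
    hu.mono' aestronglyMeasurable_const ((ae_restrict_mem measurableSet_Ioi).mono fun x hx => by
      rw [Real.norm_of_nonneg hε.le]; exact h x hx)
  simp [integrableOn_const_iff, hε.ne'] at this

/-- `psi²` is `1 / sinh`; up to the factor `cosh 1` it dominates the derivative of `log sinh`, which
is unbounded at the origin. -/
lemma not_integrableOn_psi_sq : ¬ IntegrableOn (fun x => psi x ^ 2) (Ioo 0 1) := by
  have hd : ∀ᶠ x in 𝓝[>] (0 : ℝ), HasDerivAt (fun x => Real.log (Real.sinh x))
      (Real.cosh x / Real.sinh x) x := by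
    filter_upwards [self_mem_nhdsWithin] with x hx
    exact (Real.hasDerivAt_sinh x).log (sinh_pos hx).ne'
  refine not_integrableOn_of_tendsto_norm_atTop_of_deriv_isBigO_filter (𝓝[>] (0 : ℝ))
    (Ioo_mem_nhdsGT one_pos) (hd.mono fun x hx => hx.differentiableAt) ?_
    (Asymptotics.IsBigO.of_bound (Real.cosh 1) ?_)
  · refine tendsto_abs_atBot_atTop.comp (Real.tendsto_log_nhdsGT_zero.comp ?_)
    refine tendsto_nhdsWithin_iff.2 ⟨?_, ?_⟩
    · have := Real.continuous_sinh.tendsto 0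
      rw [Real.sinh_zero] at this
      exact this.mono_left nhdsWithin_le_nhds
    · filter_upwards [self_mem_nhdsWithin] with x hx using sinh_pos hx
  · filter_upwards [hd, Ioo_mem_nhdsGT one_pos] with x hx hx1
    have hs := sinh_pos hx1.1
    have hp : psi x ^ 2 = (Real.sinh x)⁻¹ := by
      rw [psi, inv_pow, Real.sq_sqrt hs.le]
    rw [hx.deriv, hp, norm_div, Real.norm_of_nonneg (Real.cosh_pos x).le, div_eq_mul_inv, norm_inv]
    gcongr
    exact Real.cosh_le_cosh.2 (by rw [abs_of_pos hx1.1]; simpa using hx1.2.le)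

/-- The two constant Wronskians give `w = b phi - a psi`. Growth of `phi` at infinity forces `b =
0`, and then non-integrability of `psi²` at the origin forces `a = 0`. -/
lemma eqOn_zero_of_expression_eq_zero (hw : InDomain w) (h : expression w =ᵐ[halfLine] 0) :
    EqOn w 0 (Ioi 0) := by
  obtain ⟨a, ha⟩ := exists_wronskian_const (fun _ => hasDerivAt_phi) (fun _ => hasDerivAt_phi') hw h
  obtain ⟨b, hb⟩ := exists_wronskian_const (fun _ => hasDerivAt_psi) (fun _ => hasDerivAt_psi') hw h
  have hrep : ∀ x, 0 < x → w x = phi x • b - psi x • a := by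
    intro x hx
    have hW : ((phi' x : ℂ) * psi x - phi x * psi' x) = 1 := by exact_mod_cast wronskian hx
    rw [← ha x hx, ← hb x hx]
    simp only [Complex.real_smul]
    linear_combination (-w x) * hW
  have hsq : IntegrableOn (fun x => ‖w x‖ ^ 2) (Ioi 0) := integrable_norm_sq hw.memLp
  have hb0 : b = 0 := by
    by_contra hb0
    have h1 : Tendsto (fun x => phi x * ‖b‖ - psi x * ‖a‖) atTop atTop := by
      have h2 : Tendsto (fun x => -(psi x * ‖a‖)) atTop (𝓝 (-(0 * ‖a‖))) :=
        (tendsto_psi_atTop.mul_const _).neg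
      exact (tendsto_phi_atTop.atTop_mul_const (norm_pos_iff.2 hb0)).atTop_add h2
    obtain ⟨r, hr⟩ := eventually_atTop.1 ((h1.eventually_ge_atTop 1).and (eventually_gt_atTop 0))
    refine not_integrableOn_of_le_Ioi (u := fun x => ‖w x‖ ^ 2) (a := r) one_pos ?_
      (hsq.mono_set (Ioi_subset_Ioi (hr r le_rfl).2.le))
    intro x hx
    obtain ⟨h3, h4⟩ := hr x hx.le
    refine one_le_pow₀ (h3.trans ?_)
    rw [hrep x h4]
    refine le_trans (le_of_eq ?_) (norm_sub_norm_le _ _)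
    rw [norm_smul, norm_smul, Real.norm_of_nonneg (phi_pos h4).le,
      Real.norm_of_nonneg (psi_pos h4).le]
  have ha0 : a = 0 := by
    by_contra ha0
    refine not_integrableOn_psi_sq ?_
    refine IntegrableOn.congr_fun
      (Integrable.const_mul (hsq.mono_set Ioo_subset_Ioi_self) (‖a‖ ^ 2)⁻¹)
      (fun x hx => ?_) measurableSet_Ioo
    simp only [hrep x hx.1, hb0, smul_zero, zero_sub, norm_neg, norm_smul,
      Real.norm_of_nonneg (psi_pos hx.1).le, mul_pow]
    have : ‖a‖ ≠ 0 := norm_ne_zero_iff.2 ha0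
    field_simp
  intro x hx
  rw [hrep x hx, ha0, hb0]
  simp

lemma InDomain.eqOn_green (hw : InDomain w) (h : expression w =ᵐ[halfLine] f)
    (hf : MemLp f 2 halfLine) : EqOn w (green f) (Ioi 0) := by
  have hg := (inDomain_green hf).smul (-1)
  have hz : expression (w + (-1 : ℂ) • green f) =ᵐ[halfLine] 0 := by
    filter_upwards [hw.expression_add hg, (inDomain_green hf).expression_smul (-1), h,
      expression_green hf] with x h1 h2 h3 h4
    rw [h1, Pi.add_apply, h2, Pi.smul_apply, h3, h4]
    simp
  intro x hx
  have := eqOn_zero_of_expression_eq_zero (hw.add hg) hz hx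
  simp only [Pi.add_apply, neg_smul, one_smul, Pi.zero_apply] at this
  exact sub_eq_zero.1 (by rw [sub_eq_add_neg]; exact this)

end

end SturmLiouville

/-! ### Self-adjointness. -/

/-- A symmetric surjective operator on a Hilbert space is self-adjoint. -/
lemma LinearPMap.IsFormalAdjoint.isSelfAdjoint_of_surjective {E : Type*} [NormedAddCommGroup E]
    [InnerProductSpace ℂ E] [CompleteSpace E] {T : E →ₗ.[ℂ] E} (hT : T.IsFormalAdjoint T)
    (hsurj : ∀ f, ∃ u : T.domain, T u = f) : IsSelfAdjoint T := by
  have hdense : Dense (T.domain : Set E) := by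
    rw [Submodule.dense_iff_topologicalClosure_eq_top, Submodule.topologicalClosure_eq_top_iff,
      Submodule.eq_bot_iff]
    intro z hz
    obtain ⟨u, rfl⟩ := hsurj z
    have hu : (u : E) = 0 := by
      -- With `z = T u` orthogonal to the domain and `u = T v`, symmetry gives `⟨u, u⟩ = ⟨T u, v⟩ =
      -- 0`.
      obtain ⟨v, hv⟩ := hsurj (u : E)
      have h1 := hT u v
      rw [hv, (Submodule.mem_orthogonal' _ _).1 hz v v.2] at h1
      exact inner_self_eq_zero.1 h1.symm
    rw [show u = 0 from Subtype.ext hu, map_zero]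
  have key : ∀ y : T.adjoint.domain, ∃ u : T.domain, (u : E) = y ∧ T u = T.adjoint y := by
    intro y
    -- This `u` satisfies `⟨u, T w⟩ = ⟨y, T w⟩` for all `w`, and the vectors `T w` exhaust the
    -- space.
    obtain ⟨u, hu⟩ := hsurj (T.adjoint y)
    refine ⟨u, ext_inner_right ℂ fun v => ?_, hu⟩
    obtain ⟨w, rfl⟩ := hsurj v
    rw [← hT u w, hu, LinearPMap.adjoint_isFormalAdjoint hdense y w]
  rw [LinearPMap.isSelfAdjoint_def]
  refine le_antisymm (show T.adjoint ≤ T from ⟨fun y hy => ?_, fun x y hxy => ?_⟩)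
    (hT.le_adjoint hdense)
  · obtain ⟨u, hu, -⟩ := key ⟨y, hy⟩
    have hmem := u.2
    rwa [hu] at hmem
  · obtain ⟨u, hu, hTu⟩ := key x
    rw [← hTu, show u = y from Subtype.ext (hu.trans hxy)]

namespace SturmLiouville

lemma operator_apply_ae (u : operator.domain) :
    operator u =ᵐ[halfLine] expression (rep u) :=
  MemLp.coeFn_toLp (rep_inDomain u).memLp_expression

lemma coe_ae_eq_green (u : operator.domain) : (u : L2) =ᵐ[halfLine] green (operator u) :=
  (coe_ae_eq_rep u).trans (ae_eq_of_eqOn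
    ((rep_inDomain u).eqOn_green (operator_apply_ae u).symm (Lp.memLp _)))

/-- Both arguments are Green potentials of their images, so symmetry of the kernel replaces
integration by parts. -/
lemma operator_isFormalAdjoint : operator.IsFormalAdjoint operator := by
  intro u v
  rw [L2.inner_def, L2.inner_def]
  have h := integral_green_mul_comm (Lp.memLp (operator u)) (Lp.memLp (operator v))
  calc ∫ x, inner ℂ ((operator u : L2) x) ((v : L2) x) ∂halfLine
      = ∫ x, starRingEnd ℂ ((operator u : L2) x) * green (operator v) x ∂halfLine := by
        refine integral_congr_ae ?_
        filter_upwards [coe_ae_eq_green v] with x hx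
        rw [hx, RCLike.inner_apply, mul_comm]
    _ = _ := h
    _ = _ := by
        refine integral_congr_ae ?_
        filter_upwards [coe_ae_eq_green u] with x hx
        rw [hx, RCLike.inner_apply, mul_comm]

lemma operator_surjective (f : L2) : ∃ u : operator.domain, operator u = f := by
  have hf : MemLp f 2 halfLine := Lp.memLp f
  let u : operator.domain := ⟨(memLp_green hf).toLp _, green f, inDomain_green hf,
    MemLp.coeFn_toLp (memLp_green hf)⟩
  refine ⟨u, Lp.ext ?_⟩
  exact (operator_apply_ae u).trans ((expression_rep_ae_eq u (inDomain_green hf)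
    (MemLp.coeFn_toLp (memLp_green hf))).trans (expression_green hf))

theorem operator_isSelfAdjoint : IsSelfAdjoint operator :=
  operator_isFormalAdjoint.isSelfAdjoint_of_surjective operator_surjective

/-! ### Absence of eigenvalues. -/

section

variable {f : ℝ → ℂ}

/-- Dominated convergence: `phi_le_mul` lets the kernel absorb `x⁻¹`, and for fixed `y` the factor
`√(sinh x)` sends the quotient to 0. -/
lemma tendsto_green_div (hf : MemLp f 2 halfLine) :
    Tendsto (fun x => x⁻¹ * ‖green f x‖) (𝓝[>] 0) (𝓝 0) := by
  have hlim : Tendsto (fun x => ∫ y, x⁻¹ * (greenKernel x y * ‖f y‖) ∂halfLine) (𝓝[>] 0)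
      (𝓝 (∫ _, 0 ∂halfLine)) := by
    refine tendsto_integral_filter_of_dominated_convergence
      -- The factor `e` pays for moving the kernel from `x < 1` to the origin.
      (fun y => Real.exp 1 * (expKernel (0 - y) * ‖f y‖)) ?_ ?_
      ((integrable_expKernel_mul hf 0).const_mul _) ?_
    · refine Eventually.of_forall fun x => ?_
      exact ((measurable_greenKernel.comp
        (measurable_const.prodMk measurable_id)).aestronglyMeasurable.mul hf.1.norm).const_mul _
    · filter_upwards [Ioo_mem_nhdsGT one_pos] with x hx
      filter_upwards [ae_halfLine_pos] with y hy
      have hx0 : 0 < x := hx.1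
      have hbound : greenKernel x y ≤ x * (Real.exp 1 * expKernel (0 - y)) := by
        have hk : expKernel (x - y) ≤ Real.exp 1 * expKernel (0 - y) := by
          rw [expKernel, expKernel, ← Real.exp_add]
          refine Real.exp_le_exp.2 ?_
          rw [zero_sub, abs_neg, abs_of_pos hy]
          have := neg_abs_le (x - y)
          linarith [hx.2]
        rcases le_total x y with h | h
        · rw [greenKernel_of_ge h]
          calc phi x * psi y ≤ (x * √(Real.sinh x)) * psi y :=
                mul_le_mul_of_nonneg_right (phi_le_mul hx0) (psi_pos hy).le
            _ = x * (√(Real.sinh x) * psi y) := by ring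
            _ ≤ x * (Real.exp 1 * expKernel (0 - y)) :=
                mul_le_mul_of_nonneg_left ((sqrt_sinh_mul_psi_le hx0 h).trans hk) hx0.le
        · rw [greenKernel_of_le h]
          calc phi y * psi x ≤ (y * √(Real.sinh y)) * psi x :=
                mul_le_mul_of_nonneg_right (phi_le_mul hy) (psi_pos hx0).le
            _ = y * (√(Real.sinh y) * psi x) := by ring
            _ ≤ x * (Real.exp 1 * expKernel (0 - y)) := by
                refine mul_le_mul h ?_ (mul_nonneg (Real.sqrt_nonneg _) (psi_pos hx0).le) hx0.le
                refine (sqrt_sinh_mul_psi_le hy h).trans ?_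
                rw [expKernel_sub_comm]; exact hk
      have hk0 := greenKernel_nonneg hx0 hy
      rw [Real.norm_of_nonneg (by positivity), inv_mul_le_iff₀ hx0]
      calc greenKernel x y * ‖f y‖ ≤ x * (Real.exp 1 * expKernel (0 - y)) * ‖f y‖ := by gcongr
        _ = _ := by ring
    · filter_upwards [ae_halfLine_pos] with y hy
      have h1 : Tendsto (fun x => √(Real.sinh x) * psi y * ‖f y‖) (𝓝[>] 0)
          (𝓝 (√(Real.sinh 0) * psi y * ‖f y‖)) := by
        have hc : Continuous fun x => √(Real.sinh x) * psi y * ‖f y‖ := by fun_prop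
        exact (hc.tendsto 0).mono_left nhdsWithin_le_nhds
      simp only [Real.sinh_zero, Real.sqrt_zero, zero_mul] at h1
      refine squeeze_zero' ?_ ?_ h1
      · filter_upwards [self_mem_nhdsWithin] with x hx
        exact mul_nonneg (inv_nonneg.2 (le_of_lt hx))
          (mul_nonneg (greenKernel_nonneg hx hy) (norm_nonneg _))
      · filter_upwards [Ioo_mem_nhdsGT hy] with x hx
        rw [greenKernel_of_ge hx.2.le, inv_mul_le_iff₀ hx.1]
        calc phi x * psi y * ‖f y‖ ≤ (x * √(Real.sinh x)) * psi y * ‖f y‖ := by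
              have := psi_pos hy
              gcongr
              exact phi_le_mul hx.1
          _ = _ := by ring
  rw [integral_zero] at hlim
  refine squeeze_zero' ?_ ?_ hlim
  · filter_upwards [self_mem_nhdsWithin] with x hx
    exact mul_nonneg (inv_nonneg.2 (le_of_lt hx)) (norm_nonneg _)
  · filter_upwards [self_mem_nhdsWithin] with x hx
    rw [integral_const_mul]
    refine mul_le_mul_of_nonneg_left ?_ (inv_nonneg.2 (le_of_lt hx))
    refine (norm_integral_le_integral_norm _).trans (le_of_eq (integral_congr_ae ?_))
    filter_upwards [ae_halfLine_pos] with y hy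
    rw [norm_smul, Real.norm_of_nonneg (greenKernel_nonneg hx hy)]

/-- Beyond 1 the derivatives of `psi` and `phi` obey the same bounds as the functions, up to a
factor 2. This puts the derivative in L² near infinity. -/
lemma norm_greenDeriv_le (hf : MemLp f 2 halfLine) {x : ℝ} (hx : 1 ≤ x) :
    ‖greenDeriv f x‖ ≤ 2 * expConv f x := by
  have hx0 : 0 < x := by linarith
  have hint : IntegrableOn (fun y => expKernel (x - y) * ‖f y‖) (Ioi 0) :=
    integrable_expKernel_mul hf x
  have hsplit : expConv f x = (∫ y in Ioc 0 x, expKernel (x - y) * ‖f y‖) +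
      ∫ y in Ioi x, expKernel (x - y) * ‖f y‖ := by
    rw [expConv, halfLine, ← Ioc_union_Ioi_eq_Ioi hx0.le]
    exact setIntegral_union (Ioc_disjoint_Ioi le_rfl) measurableSet_Ioi
      (hint.mono_set Ioc_subset_Ioi_self) (hint.mono_set (Ioi_subset_Ioi hx0.le))
  have h1 : ‖psi' x • lowerCoeff f x‖ ≤ 2 * ∫ y in Ioc 0 x, expKernel (x - y) * ‖f y‖ := by
    rw [lowerCoeff, ← integral_smul, ← integral_const_mul]
    refine norm_integral_le_of_norm_le
      (Integrable.const_mul (hint.mono_set Ioc_subset_Ioi_self) 2) ?_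
    filter_upwards [ae_restrict_mem measurableSet_Ioc] with y hy
    rw [norm_smul, norm_smul, Real.norm_of_nonneg (phi_pos hy.1).le, Real.norm_eq_abs]
    have h3 := phi_mul_psi_le hy.1 hy.2
    rw [expKernel_sub_comm] at h3
    have h4 : |psi' x| * phi y ≤ expKernel (x - y) :=
      (mul_le_mul_of_nonneg_right (abs_psi'_le hx) (phi_pos hy.1).le).trans
        (by rw [mul_comm]; exact h3)
    have h5 := mul_le_mul_of_nonneg_right h4 (norm_nonneg (f y))
    have h6 := mul_nonneg (expKernel_pos (x - y)).le (norm_nonneg (f y))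
    linarith
  have h2 : ‖phi' x • upperCoeff f x‖ ≤ 2 * ∫ y in Ioi x, expKernel (x - y) * ‖f y‖ := by
    rw [upperCoeff, ← integral_smul, ← integral_const_mul]
    refine norm_integral_le_of_norm_le
      (Integrable.const_mul (hint.mono_set (Ioi_subset_Ioi hx0.le)) 2) ?_
    filter_upwards [ae_restrict_mem measurableSet_Ioi] with y hy
    have hy : x < y := hy
    have hpy := psi_pos (hx0.trans hy)
    rw [norm_smul, norm_smul, Real.norm_of_nonneg hpy.le, Real.norm_eq_abs]
    have h3 := sqrt_sinh_mul_psi_le hx0 hy.le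
    have h4 : |phi' x| * psi y ≤ 2 * expKernel (x - y) :=
      (mul_le_mul_of_nonneg_right (abs_phi'_le hx) hpy.le).trans (by linarith)
    have h5 := mul_le_mul_of_nonneg_right h4 (norm_nonneg (f y))
    linarith
  rw [hsplit, mul_add]
  exact (norm_add_le _ _).trans (add_le_add h1 h2)

end

/-- The energy `|D|² + (l - P) |G|²` of a solution `G` with derivative `D` is nondecreasing, and
vanishes at both ends. -/
lemma eqOn_zero_of_energy {G D : ℝ → ℂ} {l : ℝ} (hG : ∀ x, 0 < x → HasDerivAt G (D x) x)
    (hD : ∀ x, 0 < x → HasDerivAt D ((potential x - l) • G x) x)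
    (h0 : Tendsto (fun x => x⁻¹ * ‖G x‖) (𝓝[>] 0) (𝓝 0))
    (hGint : IntegrableOn (fun x => ‖G x‖ ^ 2) (Ioi 1))
    (hDint : IntegrableOn (fun x => ‖D x‖ ^ 2) (Ioi 1)) : EqOn G 0 (Ioi 0) := by
  set e : ℝ → ℝ := fun x => ‖D x‖ ^ 2 + (l - potential x) * ‖G x‖ ^ 2 with he
  have hderiv : ∀ x, 0 < x →
      HasDerivAt e (3 / 2 * Real.cosh x / Real.sinh x ^ 3 * ‖G x‖ ^ 2) x := by
    intro x hx
    convert! (hD x hx).norm_sq.add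
      (((hasDerivAt_potential hx).const_sub l).mul (hG x hx).norm_sq) using 1
    rw [inner_smul_right, real_inner_comm (G x) (D x)]
    ring
  have hmono : MonotoneOn e (Ioi 0) := by
    refine monotoneOn_of_deriv_nonneg (convex_Ioi 0)
      (fun x hx => (hderiv x hx).continuousAt.continuousWithinAt) ?_ ?_
    · rw [interior_Ioi]
      exact fun x hx => (hderiv x hx).differentiableAt.differentiableWithinAt
    · rw [interior_Ioi]
      intro x hx
      have := sinh_pos hx
      have := Real.cosh_pos x
      rw [(hderiv x hx).deriv]
      positivity
  have hnonneg : ∀ x, 0 < x → 0 ≤ e x := by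
    intro x hx
    -- Since `P ≤ 1/t²` and `-l ≤ |l|/t²` for `t < 1`, this is a lower bound for the energy near the
    -- origin; monotonicity carries its limit 0 to `x`.
    have hlim : Tendsto (fun t => -(|l| + 1) * (t⁻¹ * ‖G t‖) ^ 2) (𝓝[>] 0)
        (𝓝 (-(|l| + 1) * 0 ^ 2)) := (h0.pow 2).const_mul _
    rw [zero_pow two_ne_zero, mul_zero] at hlim
    refine le_of_tendsto hlim ?_
    filter_upwards [Ioo_mem_nhdsGT hx, Ioo_mem_nhdsGT one_pos] with t ht ht1
    have ht0 : 0 < t := ht.1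
    refine le_trans ?_ (hmono ht0 hx ht.2.le)
    have hsinh : t ≤ Real.sinh t := Real.self_le_sinh_iff.2 ht0.le
    have hp : potential t ≤ 1 / t ^ 2 := by
      rw [potential_eq ht0]
      have h1 : 3 / 4 / Real.sinh t ^ 2 ≤ 3 / 4 / t ^ 2 := by gcongr
      have h2 : 1 ≤ 1 / t ^ 2 := by
        rw [le_div_iff₀ (by positivity), one_mul]
        exact pow_le_one₀ ht0.le ht1.2.le
      have h3 : 3 / 4 / t ^ 2 = 3 / 4 * (1 / t ^ 2) := by ring
      linarith
    have hl : -(|l| * (1 / t ^ 2)) ≤ l := by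
      have h2 : 1 ≤ 1 / t ^ 2 := by
        rw [le_div_iff₀ (by positivity), one_mul]
        exact pow_le_one₀ ht0.le ht1.2.le
      nlinarith [neg_abs_le l, abs_nonneg l]
    have h4 : -(|l| + 1) * (1 / t ^ 2) ≤ l - potential t := by linarith
    have h5 := mul_le_mul_of_nonneg_right h4 (sq_nonneg ‖G t‖)
    have h6 : -(|l| + 1) * (t⁻¹ * ‖G t‖) ^ 2 = -(|l| + 1) * (1 / t ^ 2) * ‖G t‖ ^ 2 := by
      rw [mul_pow, inv_pow]; ring
    rw [h6, he]
    simp only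
    linarith [sq_nonneg ‖D t‖]
  have hnonpos : ∀ x, 0 < x → e x ≤ 0 := by
    intro x hx
    by_contra! hpos
    -- As `P > 0`, this integrable function dominates the energy, which stays above `e x` to the
    -- right of `x`.
    have hint : IntegrableOn (fun t => ‖D t‖ ^ 2 + |l| * ‖G t‖ ^ 2) (Ioi (max x 1)) :=
      IntegrableOn.mono_set (Integrable.add hDint (hGint.const_mul |l|))
        (Ioi_subset_Ioi (le_max_right _ _))
    refine not_integrableOn_of_le_Ioi hpos (fun t ht => ?_) hint
    have hxt : x < t := (le_max_left _ _).trans_lt ht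
    have ht0 : 0 < t := hx.trans hxt
    refine (hmono hx ht0 hxt.le).trans ?_
    have h1 : l - potential t ≤ |l| := by linarith [potential_pos ht0, le_abs_self l]
    have h2 := mul_le_mul_of_nonneg_right h1 (sq_nonneg ‖G t‖)
    simp only [he]
    linarith
  intro x hx
  have hx : 0 < x := hx
  -- The energy is now identically zero, and its derivative is a strictly positive multiple of
  -- `|G|²`.
  have hzero : HasDerivAt e 0 x := (hasDerivAt_const x (0 : ℝ)).congr_of_eventuallyEq
    (Filter.mem_of_superset (Ioi_mem_nhds hx) fun y hy => le_antisymm (hnonpos y hy) (hnonneg y hy))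
  have h := (hderiv x hx).unique hzero
  have hs := sinh_pos hx
  have hc := Real.cosh_pos x
  have hne : 3 / 2 * Real.cosh x / Real.sinh x ^ 3 ≠ 0 := by positivity
  simpa [hne] using (mul_eq_zero.1 h).resolve_left hne

/-- Writing `w` as the Green potential of `l w` supplies the decay at the origin and the
integrability near infinity that the energy argument needs. -/
lemma InDomain.eqOn_zero_of_expression_eq_smul {w : ℝ → ℂ} (hw : InDomain w) {l : ℝ}
    (h : expression w =ᵐ[halfLine] (l : ℂ) • w) : EqOn w 0 (Ioi 0) := by
  have hf : MemLp ((l : ℂ) • w) 2 halfLine := hw.memLp.const_smul _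
  have heq := hw.eqOn_green h hf
  have hderiv : ∀ x, 0 < x → HasDerivAt (greenDeriv ((l : ℂ) • w))
      ((potential x - l) • green ((l : ℂ) • w) x) x := by
    intro x hx
    refine (locallyAC_greenDeriv hf).hasDerivAt_of_ae
      (g := fun x => (potential x - l) • green ((l : ℂ) • w) x) ?_ ?_ hx
    · exact (continuousOn_potential.sub continuousOn_const).smul (locallyAC_green hf).continuousOn
    · filter_upwards [ae_hasDerivAt_greenDeriv hf, ae_halfLine_pos] with y hy hy0
      convert! hy using 1
      simp only [Pi.smul_apply, heq hy0, Complex.real_smul, smul_eq_mul, Complex.ofReal_sub]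
      ring
  have hGint : IntegrableOn (fun x => ‖green ((l : ℂ) • w) x‖ ^ 2) (Ioi 0) :=
    integrable_norm_sq (memLp_green hf)
  have hz := eqOn_zero_of_energy (fun x hx => hasDerivAt_green hf hx) hderiv
    (tendsto_green_div hf) (hGint.mono_set (Ioi_subset_Ioi zero_le_one))
    (integrable_of_norm_le_expConv_sq hf measurableSet_Ioi
      (((locallyAC_greenDeriv hf).continuousOn.mono
        (Ioi_subset_Ioi zero_le_one)).aestronglyMeasurable measurableSet_Ioi)
      fun x hx => norm_greenDeriv_le hf (le_of_lt hx))
  exact heq.trans hz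

/-- Symmetry makes an eigenvalue real, as the energy argument requires. -/
lemma eq_zero_of_operator_apply_eq_smul {u : operator.domain} {μ : ℂ}
    (h : operator u = μ • (u : L2)) : (u : L2) = 0 := by
  by_contra hne
  have hreal : starRingEnd ℂ μ = μ := by
    have h1 := operator_isFormalAdjoint u u
    rw [h, inner_smul_left, inner_smul_right] at h1
    exact mul_right_cancel₀ (inner_self_ne_zero.2 hne) h1
  obtain ⟨l, rfl⟩ := Complex.conj_eq_iff_real.1 hreal
  refine hne (Lp.eq_zero_iff_ae_eq_zero.2 ?_)
  have hexp : expression (rep u) =ᵐ[halfLine] (l : ℂ) • rep u := by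
    have h1 := operator_apply_ae u
    rw [h] at h1
    exact h1.symm.trans ((Lp.coeFn_smul _ _).trans ((coe_ae_eq_rep u).const_smul _))
  exact (coe_ae_eq_rep u).trans
    (ae_eq_of_eqOn ((rep_inDomain u).eqOn_zero_of_expression_eq_smul hexp))

end SturmLiouville

end

theorem theoremA1 :
    IsSelfAdjoint SturmLiouville.operator ∧
      SturmLiouville.discreteSpectrum SturmLiouville.operator = ∅ := by
  refine ⟨SturmLiouville.operator_isSelfAdjoint, ?_⟩
  rw [Set.eq_empty_iff_forall_notMem]
  rintro μ ⟨w, hne, hw⟩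
  exact hne (SturmLiouville.eq_zero_of_operator_apply_eq_smul hw)
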